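/- Let $(G_i)_{i\in I}$ be a family of groups. For finite $X\subseteq I$ let $\ast_{i\in X}G_i$ be the free product (trivial for $X=\emptyset$), and for finite $X\subseteq Y\subseteq I$ let $p_{XY}:\ast_{i\in Y}G_i\to\ast_{i\in X}G_i$ be the canonical homomorphism, which is the identity on $G_i$ for $i\in X$ and trivial on $G_i$ for $i\in Y\setminus X$. Let $\varprojlim \ast G_i$ be the inverse limit of the groups $\ast_{i\in X}G_i$ ($X\subseteq I$ finite) along the maps $p_{XY}$ (the unrestricted free product). For $S\subseteq I$ let $p_S:\varprojlim\ast G_i\to\varprojlim\ast G_i$ be the homomorphism $p_S(x)(X)=x(X\cap S)$ for finite $X\subseteq I$, where $\ast_{i\in X\cap S}G_i$ is regarded as a subgroup of $\ast_{i\in X}G_i$. Let $F$ be a free group and $h:\varprojlim\ast G_i\to F$ a homomorphism. (1) If $I\neq\emptyset$, there are $m\ge 0$ and countably complete (possibly principal) ultrafilters $u_0,\dots,u_m$ on $I$ such that $h=h\circ p_{U_0\cup\dots\cup U_m}$ for all $U_0\in u_0,\dots,U_m\in u_m$. If moreover $|I|$ is less than the least measurable cardinal, these ultrafilters are principal. (2)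 If $|I|$ is less than the least measurable cardinal, then there are a finite subset $X_0\subseteq I$ and a homomorphism $\overline h:\ast_{i\in X_0}G_i\to F$ such that $h=\overline h\circ p_{X_0}$, where $p_{X_0}:\varprojlim\ast G_i\to\ast_{i\in X_0}G_i$ is the canonical projection. Here a measurable cardinal is an uncountable cardinal $\kappa$ such that a set of cardinality $\kappa$ carries a $\kappa$-complete nonprincipal ultrafilter; if no measurable cardinal exists, every $|I|$ counts as less than the least one. -/

import Mathlib

noncomputable section

open scoped Classical in
/-- The canonical homomorphism `∗_{i ∈ Y} G i →* ∗_{i ∈ X} G i` between finite free products: it is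
the identity on every factor `G i` with `i ∈ X ∩ Y` and trivial on the other factors. For `X ⊆ Y`
it is the projection, for `Y ⊆ X` it is the inclusion. -/
def freeProductMap {I : Type*} (G : I → Type*) [∀ i, Group (G i)] (X Y : Finset I) :
    Monoid.CoprodI (fun i : Y => G i) →* Monoid.CoprodI (fun i : X => G i) :=
  Monoid.CoprodI.lift fun i : Y =>
    if h : (i : I) ∈ X then
      (Monoid.CoprodI.of (M := fun i : X => G i) (i := ⟨(i : I), h⟩) : G i →* _)
    else 1

/-- `freeProductMap` is functorial along index sets that do not lose a common factor. -/
theorem freeProductMap_comp {I : Type*} (G : I → Type*) [∀ i, Group (G i)] (X Y Z : Finset I)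
    (h : ∀ i, i ∈ X → i ∈ Z → i ∈ Y) (a : Monoid.CoprodI (fun i : Z => G i)) :
    freeProductMap G X Y (freeProductMap G Y Z a) = freeProductMap G X Z a := by
  suffices H : (freeProductMap G X Y).comp (freeProductMap G Y Z) = freeProductMap G X Z from
    DFunLike.congr_fun H a
  refine Monoid.CoprodI.ext_hom _ _ fun i => MonoidHom.ext fun g => ?_
  have hi := h i
  have hZ := i.2
  by_cases hX : (i : I) ∈ X <;> by_cases hY : (i : I) ∈ Y <;>
    simp_all [freeProductMap]

/-- The unrestricted free product `lim← ∗ G i`: the inverse limit of the finite free products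
`∗_{i ∈ X} G i`, `X` a finite subset of `I`, along the projections for `X ⊆ Y`. -/
def unrestrictedFreeProduct {I : Type*} (G : I → Type*) [∀ i, Group (G i)] :
    Subgroup (∀ X : Finset I, Monoid.CoprodI (fun i : X => G i)) where
  carrier := {x | ∀ X Y : Finset I, X ⊆ Y → freeProductMap G X Y (x Y) = x X}
  mul_mem' := fun {x y} hx hy X Y h => by
    rw [Pi.mul_apply, Pi.mul_apply, map_mul, hx X Y h, hy X Y h]
  one_mem' := fun X Y _ => by rw [Pi.one_apply, Pi.one_apply, map_one]
  inv_mem' := fun {x} hx X Y h => by rw [Pi.inv_apply, Pi.inv_apply, map_inv, hx X Y h]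

open scoped Classical in
/-- For `S ⊆ I`, the endomorphism `p_S` of the unrestricted free product given by
`p_S(x)(X) = x(X ∩ S)`, where `∗_{i ∈ X ∩ S} G i` is regarded as a subgroup of `∗_{i ∈ X} G i`
through the canonical inclusion. -/
def projSet {I : Type*} (G : I → Type*) [∀ i, Group (G i)] (S : Set I) :
    unrestrictedFreeProduct G →* unrestrictedFreeProduct G where
  toFun x := ⟨fun X => freeProductMap G X (X.filter (· ∈ S)) (x.1 (X.filter (· ∈ S))), by
    intro X Y h
    have hXY : X.filter (· ∈ S) ⊆ Y.filter (· ∈ S) := Finset.filter_subset_filter _ h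
    beta_reduce
    rw [← x.2 _ _ hXY, freeProductMap_comp, freeProductMap_comp]
    · intro i hX hY
      exact Finset.mem_filter.2 ⟨hX, (Finset.mem_filter.1 hY).2⟩
    · intro i _ hY
      exact (Finset.mem_filter.1 hY).1⟩
  map_one' := Subtype.ext <| funext fun X => map_one (freeProductMap G X _)
  map_mul' x y := Subtype.ext <| funext fun X => map_mul (freeProductMap G X _) _ _

/-- The canonical projection of the unrestricted free product to `∗_{i ∈ X} G i`. -/
def projFinset {I : Type*} (G : I → Type*) [∀ i, Group (G i)] (X : Finset I) :
    unrestrictedFreeProduct G →* Monoid.CoprodI (fun i : X => G i) where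
  toFun x := x.1 X
  map_one' := rfl
  map_mul' _ _ := rfl

/-- A cardinal `κ` is measurable if it is uncountable and a set of cardinality `κ` carries a
`κ`-complete nonprincipal ultrafilter. -/
def IsMeasurableCardinal (κ : Cardinal) : Prop :=
  Cardinal.aleph0 < κ ∧ ∃ u : Ultrafilter κ.out,
    CardinalInterFilter (u : Filter κ.out) κ ∧ ∀ a : κ.out, u ≠ pure a

/-- The cardinality of `I` is less than the least measurable cardinal (which holds in particular
if there is no measurable cardinal). -/
def BelowLeastMeasurable (I : Type*) : Prop :=
  ∀ κ : Cardinal, IsMeasurableCardinal κ → Cardinal.mk I < κ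

end

open Filter Set

/-! The sets `S` with `h = h ∘ p_S` form a filter. Call a sequence null if each finite coordinate is
eventually trivial. For null `y`, the infinite nested words `x n = y n * x (n + 1) ^ k n` exist in
the inverse limit, while in a free group fast-growing `k` forces some `h (y n) = 1`; hence
`eventually_map_eq_one`. Suitable null sequences show that the filter is countably complete and that
no infinite disjoint sequence is positive for it. So it is refined by finitely many ultrafilters,
each countably complete, and a union of their members lies in the filter. Below the least measurable
cardinal they are principal, and singletons give a finite `S`. -/

/-- With `x = c r c⁻¹` and `r` cyclically reduced, the word `c r ⋯ r c⁻¹` is already reduced. -/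
theorem FreeGroup.norm_pow_succ {α : Type*} [DecidableEq α] (x : FreeGroup α) (n : ℕ) :
    (x ^ (n + 1)).norm = 2 * (reduceCyclically.conjugator x.toWord).length +
      (n + 1) * (reduceCyclically x.toWord).length := by
  rw [FreeGroup.norm, FreeGroup.toWord_pow,
    reduceCyclically.reduce_flatten_replicate_succ FreeGroup.isReduced_toWord]
  simp
  ring

theorem FreeGroup.norm_le_norm_pow_succ {α : Type*} [DecidableEq α] (x : FreeGroup α) (n : ℕ) :
    x.norm ≤ (x ^ (n + 1)).norm := by
  have h := FreeGroup.norm_pow_succ x 0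
  rw [zero_add, pow_one] at h
  rw [h, FreeGroup.norm_pow_succ]
  gcongr
  omega

theorem FreeGroup.succ_le_norm_pow_succ {α : Type*} [DecidableEq α] {x : FreeGroup α}
    (hx : x ≠ 1) (n : ℕ) : n + 1 ≤ (x ^ (n + 1)).norm := by
  rw [FreeGroup.norm_pow_succ]
  have hpos : 0 < (reduceCyclically x.toWord).length := by
    refine List.length_pos_iff.2 fun h0 => hx ?_
    have h := congr_arg FreeGroup.mk (reduceCyclically.conj_conjugator_reduceCyclically x.toWord)
    rw [h0, List.append_nil, ← FreeGroup.mul_mk, ← FreeGroup.inv_mk, mul_inv_cancel,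
      FreeGroup.mk_toWord] at h
    exact h.symm
  nlinarith

/-- In a free group the system of equations `b n = a n * b (n + 1) ^ (k n + 1)` has no solution if
the exponents grow fast in terms of the lengths of the nontrivial elements `a n`. -/
theorem FreeGroup.exists_eq_one_of_mul_pow {α : Type*} [DecidableEq α] (a b : ℕ → FreeGroup α)
    (hab : ∀ n, b n = a n *
      b (n + 1) ^ ((∑ i ∈ Finset.range (n + 1), (a i).norm) + n + 1)) : ∃ n, a n = 1 := by
  have key : ∀ n, (b (n + 1) ^ ((∑ i ∈ Finset.range (n + 1), (a i).norm) + n + 1)).norm ≤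
      (a n).norm + (b n).norm := fun n => by
    have h : b (n + 1) ^ ((∑ i ∈ Finset.range (n + 1), (a i).norm) + n + 1) =
        (a n)⁻¹ * b n := by rw [eq_inv_mul_iff_mul_eq, ← hab n]
    rw [h]
    exact (FreeGroup.norm_mul_le _ _).trans_eq (by rw [FreeGroup.norm_inv_eq])
  -- A positive power is no shorter than its base, so `key` telescopes.
  have bound : ∀ n, (b n).norm ≤ (∑ i ∈ Finset.range n, (a i).norm) + (b 0).norm := by
    intro n
    induction n with
    | zero => simp
    | succ n ih =>
      have h1 := key n
      have h2 := FreeGroup.norm_le_norm_pow_succ (b (n + 1))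
        ((∑ i ∈ Finset.range (n + 1), (a i).norm) + n)
      rw [Finset.sum_range_succ] at *
      omega
  -- Once `n ≥ |b 0|`, the exponent exceeds the length that `key` and `bound` allow for the power.
  have trivial_of_le : ∀ n, (b 0).norm ≤ n → b (n + 1) = 1 := by
    intro n hn
    by_contra hne
    have h1 := key n
    have h2 := FreeGroup.succ_le_norm_pow_succ hne
      ((∑ i ∈ Finset.range (n + 1), (a i).norm) + n)
    have h3 := bound n
    rw [Finset.sum_range_succ] at *
    omega
  refine ⟨(b 0).norm + 1, ?_⟩
  have h := hab ((b 0).norm + 1)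
  rw [trivial_of_le _ le_rfl, trivial_of_le _ (Nat.le_succ _), one_pow, mul_one] at h
  exact h.symm

/-! ### Null sequences and infinite nested words -/

/-- The finite approximations `a n * (a (n + 1) * (a (n + 2) * ⋯) ^ k (n + 1)) ^ k n`. -/
def nestedProd {K : Type*} [Group K] (a : ℕ → K) (k : ℕ → ℕ) : ℕ → ℕ → K
  | 0, _ => 1
  | d + 1, n => a n * nestedProd a k d (n + 1) ^ k n

theorem map_nestedProd {K L : Type*} [Group K] [Group L] (f : K →* L) (a : ℕ → K) (k : ℕ → ℕ)
    (d n : ℕ) : f (nestedProd a k d n) = nestedProd (fun m => f (a m)) k d n := by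
  induction d generalizing n with
  | zero => exact map_one f
  | succ d ih => simp only [nestedProd, map_mul, map_pow, ih]

theorem nestedProd_eq_of_le {K : Type*} [Group K] {a : ℕ → K} (k : ℕ → ℕ) {N : ℕ}
    (ha : ∀ m, N ≤ m → a m = 1) {d e n : ℕ} (hd : N ≤ n + d) (hde : d ≤ e) :
    nestedProd a k e n = nestedProd a k d n := by
  induction d generalizing e n with
  | zero =>
    induction e generalizing n with
    | zero => rfl
    | succ e ih =>
      rw [nestedProd.eq_2, ih (by omega) (Nat.zero_le _), ha n (by omega), nestedProd.eq_1, nestedProd.eq_1,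
        one_pow, one_mul]
  | succ d ih =>
    obtain ⟨e, rfl⟩ : ∃ e', e = e' + 1 := ⟨e - 1, by omega⟩
    rw [nestedProd, nestedProd, ih (by omega) (by omega)]

section UnrestrictedFreeProduct

variable {I : Type*} (G : I → Type*) [∀ i, Group (G i)]

theorem freeProductMap_self (X : Finset I) : freeProductMap G X X = MonoidHom.id _ := by
  refine Monoid.CoprodI.ext_hom _ _ fun i => MonoidHom.ext fun g => ?_
  simp [freeProductMap]

variable {G}

/-- Infinitely nested words in a null sequence exist in the unrestricted free product. -/
theorem exists_nested_solution (y : ℕ → unrestrictedFreeProduct G)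
    (hy : ∀ X, ∀ᶠ n in atTop, (y n).1 X = 1) (k : ℕ → ℕ) :
    ∃ x : ℕ → unrestrictedFreeProduct G, ∀ n, x n = y n * x (n + 1) ^ k n := by
  choose N hN using fun X => eventually_atTop.1 (hy X)
  -- In coordinate `X`, depth `N X` suffices from every start `n`.
  have stable : ∀ X n d e, N X ≤ d → N X ≤ e →
      (nestedProd y k d n).1 X = (nestedProd y k e n).1 X := by
    intro X n d e hd he
    have hmap : ∀ d, (nestedProd y k d n).1 X = nestedProd (fun m => (y m).1 X) k d n :=
      fun d => map_nestedProd (projFinset G X) y k d n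
    rw [hmap, hmap, nestedProd_eq_of_le k (hN X) (show N X ≤ n + N X by omega) hd,
      nestedProd_eq_of_le k (hN X) (show N X ≤ n + N X by omega) he]
  refine ⟨fun n => ⟨fun X => (nestedProd y k (N X) n).1 X, fun X Y h => ?_⟩,
    fun n => Subtype.ext <| funext fun X => ?_⟩
  · beta_reduce
    rw [stable Y n (N Y) (max (N X) (N Y)) le_rfl (le_max_right _ _),
      stable X n (N X) (max (N X) (N Y)) le_rfl (le_max_left _ _)]
    exact (nestedProd y k _ n).2 X Y h
  · change (nestedProd y k (N X) n).1 X =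
      (y n).1 X * (nestedProd y k (N X) (n + 1)).1 X ^ k n
    rw [stable X n (N X) (N X + 1) le_rfl (Nat.le_succ _)]
    rfl

/-- Homomorphisms to a free group eventually kill every null sequence. -/
theorem eventually_map_eq_one {F : Type*} [Group F] [IsFreeGroup F]
    (h : unrestrictedFreeProduct G →* F) (y : ℕ → unrestrictedFreeProduct G)
    (hy : ∀ X, ∀ᶠ n in atTop, (y n).1 X = 1) : ∀ᶠ n in atTop, h (y n) = 1 := by
  classical
  by_contra hne
  -- A subsequence of a null sequence is null, so all terms may be assumed to survive under `h`.
  obtain ⟨φ, hφ, hφne⟩ := extraction_of_frequently_atTop (not_eventually.1 hne)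
  let f := (IsFreeGroup.toFreeGroup F).toMonoidHom.comp h
  have hf : ∀ x, f x = 1 → h x = 1 := fun x hx =>
    (MulEquiv.map_eq_one_iff (IsFreeGroup.toFreeGroup F)).1 hx
  obtain ⟨x, hx⟩ := exists_nested_solution (fun n => y (φ n))
    (fun X => hφ.tendsto_atTop.eventually (hy X))
    (fun n => (∑ i ∈ Finset.range (n + 1), (f (y (φ i))).norm) + n + 1)
  obtain ⟨n, hn⟩ := FreeGroup.exists_eq_one_of_mul_pow (fun n => f (y (φ n))) (fun n => f (x n))
    (fun n => by rw [← map_pow, ← map_mul, ← hx n])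
  exact hφne n (hf _ hn)

/-! ### The projections and the support filter -/

theorem projSet_apply {S : Set I} (x : unrestrictedFreeProduct G) {X Z : Finset I}
    (hZ : ∀ i, i ∈ Z ↔ i ∈ X ∧ i ∈ S) :
    (projSet G S x).1 X = freeProductMap G X Z (x.1 Z) := by
  classical
  have h : Z = X.filter (· ∈ S) := Finset.ext fun i => (hZ i).trans Finset.mem_filter.symm
  subst h
  rfl

theorem projSet_apply_congr {S T : Set I} (x : unrestrictedFreeProduct G) {X : Finset I}
    (h : ∀ i ∈ X, i ∈ S ↔ i ∈ T) : (projSet G S x).1 X = (projSet G T x).1 X := by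
  classical
  rw [projSet_apply x (Z := X.filter (· ∈ S)) fun i => Finset.mem_filter,
    projSet_apply x (Z := X.filter (· ∈ S)) fun i => Finset.mem_filter.trans
      (and_congr_right (h i))]

theorem projSet_univ : projSet G univ = MonoidHom.id _ := by
  refine MonoidHom.ext fun x => Subtype.ext <| funext fun X => ?_
  rw [projSet_apply x (Z := X) fun i => (and_iff_left (mem_univ i)).symm, freeProductMap_self]
  rfl

theorem projSet_comp_projSet (S T : Set I) :
    (projSet G S).comp (projSet G T) = projSet G (S ∩ T) := by
  classical
  refine MonoidHom.ext fun x => Subtype.ext <| funext fun X => ?_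
  have hXS : ∀ i, i ∈ X.filter (· ∈ S) ↔ i ∈ X ∧ i ∈ S := fun i => Finset.mem_filter
  have hXST : ∀ i, i ∈ (X.filter (· ∈ S)).filter (· ∈ T) ↔ i ∈ X.filter (· ∈ S) ∧ i ∈ T :=
    fun i => Finset.mem_filter
  rw [MonoidHom.comp_apply, projSet_apply _ hXS, projSet_apply x hXST, freeProductMap_comp,
    projSet_apply x fun i => (hXST i).trans (by rw [hXS, and_assoc, mem_inter_iff])]
  exact fun i _ hi => ((hXST i).1 hi).1

variable {F : Type*} [Group F]

/-- The filter of all sets `S` such that `h` factors through `p_S`. -/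
def supportFilter (h : unrestrictedFreeProduct G →* F) : Filter I where
  sets := {S | h = h.comp (projSet G S)}
  univ_sets := by rw [mem_ofPred_eq, projSet_univ, MonoidHom.comp_id]
  sets_of_superset {S T} hS hST := by
    rw [mem_ofPred_eq] at *
    nth_rw 2 [hS]
    rw [MonoidHom.comp_assoc, projSet_comp_projSet, inter_eq_left.2 hST]
    exact hS
  inter_sets {S T} hS hT := by
    rw [mem_ofPred_eq] at *
    rw [← projSet_comp_projSet, ← MonoidHom.comp_assoc, ← hS]
    exact hT

theorem mem_supportFilter {h : unrestrictedFreeProduct G →* F} {S : Set I} :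
    S ∈ supportFilter h ↔ h = h.comp (projSet G S) := Iff.rfl

theorem exists_of_notMem_supportFilter {h : unrestrictedFreeProduct G →* F} {S : Set I}
    (hS : S ∉ supportFilter h) : ∃ y, projSet G S y = 1 ∧ h y ≠ 1 := by
  rw [mem_supportFilter, MonoidHom.ext_iff, not_forall] at hS
  obtain ⟨x, hx⟩ := hS
  refine ⟨x * (projSet G S x)⁻¹, ?_, ?_⟩
  · have := DFunLike.congr_fun (projSet_comp_projSet (G := G) S S) x
    rw [MonoidHom.comp_apply, inter_self] at this
    rw [map_mul, map_inv, this, mul_inv_cancel]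
  · rwa [map_mul, map_inv, Ne, mul_inv_eq_one]

variable [IsFreeGroup F]

theorem iInter_mem_supportFilter (h : unrestrictedFreeProduct G →* F) (T : ℕ → Set I)
    (hT : ∀ n, T n ∈ supportFilter h) : ⋂ n, T n ∈ supportFilter h := by
  by_contra hne
  obtain ⟨y, hy, hhy⟩ := exists_of_notMem_supportFilter hne
  have hD : ∀ n, ⋂ m ∈ Finset.range n, T m ∈ supportFilter h := fun n =>
    (biInter_finset_mem _).2 fun m _ => hT m
  -- On a finite `X` the partial intersections eventually agree with the full one, so these
  -- projections of `y` are null; yet `h` sends each of them to `h y`.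
  have hev : ∀ᶠ n in atTop, h (projSet G (⋂ m ∈ Finset.range n, T m) y) = 1 := by
    refine eventually_map_eq_one h _ fun X => ?_
    have hX : ∀ᶠ n in atTop, ∀ i ∈ X, (i ∈ ⋂ m ∈ Finset.range n, T m) ↔ i ∈ ⋂ m, T m := by
      refine (Finset.eventually_all X).2 fun i _ => ?_
      by_cases hi : i ∈ ⋂ m, T m
      · refine Eventually.of_forall fun n => iff_of_true ?_ hi
        exact mem_iInter₂.2 fun m _ => mem_iInter.1 hi m
      · obtain ⟨m, hm⟩ := not_forall.1 (mt mem_iInter.2 hi)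
        filter_upwards [eventually_gt_atTop m] with n hn
        exact iff_of_false (fun H => hm (mem_iInter₂.1 H m (Finset.mem_range.2 hn))) hi
    filter_upwards [hX] with n hn
    rw [projSet_apply_congr y hn, hy]
    rfl
  obtain ⟨n, hn⟩ := hev.exists
  refine hhy ?_
  rw [mem_supportFilter.1 (hD n)]
  exact hn

instance (h : unrestrictedFreeProduct G →* F) : CountableInterFilter (supportFilter h) where
  countable_sInter_mem S hS hmem := by
    rcases S.eq_empty_or_nonempty with rfl | hne
    · simp
    · obtain ⟨T, rfl⟩ := hS.exists_eq_range hne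
      rw [sInter_range]
      exact iInter_mem_supportFilter h T fun n => hmem _ (mem_range_self n)

/-- There is no infinite disjoint family of sets that are positive for the support filter. -/
theorem exists_compl_mem_supportFilter (h : unrestrictedFreeProduct G →* F) (A : ℕ → Set I)
    (hA : Pairwise (Function.onFun Disjoint A)) : ∃ n, (A n)ᶜ ∈ supportFilter h := by
  by_contra! hne
  choose y hy hhy using fun n => exists_of_notMem_supportFilter (hne n)
  -- A finite `X` meets only finitely many `A n`, so `y` is null.
  obtain ⟨n, hn⟩ := (eventually_map_eq_one h y fun X => by
    have hX : ∀ᶠ n in atTop, ∀ i ∈ X, i ∈ (univ : Set I) ↔ i ∈ (A n)ᶜ := by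
      refine (Finset.eventually_all X).2 fun i _ => ?_
      by_cases hi : ∃ m, i ∈ A m
      · obtain ⟨m, hm⟩ := hi
        filter_upwards [eventually_gt_atTop m] with n hn
        exact iff_of_true trivial (disjoint_left.1 (hA hn.ne) hm)
      · exact Eventually.of_forall fun n => iff_of_true trivial fun H => hi ⟨n, H⟩
    filter_upwards [hX] with n hn
    have := projSet_apply_congr (y n) hn
    rw [projSet_univ, hy] at this
    exact this).exists
  exact hhy n hn

/-- A homomorphism that factors through `p_S` with `S` finite factors through a finite free
product. -/
theorem exists_factor_projFinset {F : Type*} [Group F] (h : unrestrictedFreeProduct G →* F)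
    (X₀ : Finset I) (hX₀ : h = h.comp (projSet G (X₀ : Set I))) :
    ∃ h' : Monoid.CoprodI (fun i : X₀ => G i) →* F, h = h'.comp (projFinset G X₀) := by
  classical
  let ι : Monoid.CoprodI (fun i : X₀ => G i) →* unrestrictedFreeProduct G :=
    { toFun := fun w => ⟨fun X => freeProductMap G X X₀ w, fun X Y hXY =>
        freeProductMap_comp G X Y X₀ (fun i hi _ => hXY hi) w⟩
      map_one' := Subtype.ext <| funext fun X => map_one (freeProductMap G X X₀)
      map_mul' := fun v w => Subtype.ext <| funext fun X => map_mul (freeProductMap G X X₀) v w }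
  have hι : ι.comp (projFinset G X₀) = projSet G (X₀ : Set I) := by
    refine MonoidHom.ext fun x => Subtype.ext <| funext fun X => ?_
    rw [projSet_apply x (Z := X ∩ X₀) fun i => Finset.mem_inter,
      ← x.2 (X ∩ X₀) X₀ Finset.inter_subset_right, freeProductMap_comp]
    · rfl
    · exact fun i hi hi' => Finset.mem_inter.2 ⟨hi, hi'⟩
  exact ⟨h.comp ι, by rw [MonoidHom.comp_assoc, hι]; exact hX₀⟩

end UnrestrictedFreeProduct

/-! ### Ultrafilters refining a filter -/

/-- If no infinite disjoint sequence of sets is positive for `N`, then only finitely many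
ultrafilters refine `N`. -/
theorem finite_ultrafilter_le {I : Type*} (N : Filter I)
    (hN : ∀ A : ℕ → Set I, Pairwise (Function.onFun Disjoint A) → ∃ n, (A n)ᶜ ∈ N) :
    {u : Ultrafilter I | (u : Filter I) ≤ N}.Finite := by
  rw [← Set.not_infinite]
  intro hinf
  have := hinf.to_subtype
  obtain ⟨U, hUinf, hUo, hUd⟩ :=
    exists_seq_infinite_isOpen_pairwise_disjoint {u : Ultrafilter I | (u : Filter I) ≤ N}
  choose u hu using fun n => (hUinf n).nonempty
  have hbasic : ∀ n, ∃ A : Set I, A ∈ (u n).1 ∧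
      ∀ v : {u : Ultrafilter I | (u : Filter I) ≤ N}, A ∈ v.1 → v ∈ U n := by
    intro n
    obtain ⟨V, hV, hVU⟩ := isOpen_induced_iff.1 (hUo n)
    have huV : (u n).1 ∈ V := by
      have := hu n
      rwa [← hVU] at this
    obtain ⟨_, ⟨A, rfl⟩, hA, hAV⟩ := ultrafilterBasis_is_basis.exists_subset_of_mem_open huV hV
    exact ⟨A, hA, fun v hv => hVU ▸ hAV hv⟩
  choose A hA hAU using hbasic
  have hdisj : ∀ m n, m ≠ n → (A m)ᶜ ∈ (u n).1 := fun m n hmn =>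
    Ultrafilter.compl_mem_iff_notMem.2 fun H =>
      disjoint_left.1 (hUd hmn) (hAU m (u n) H) (hu n)
  -- The `A n` may overlap as sets, but `u n` omits every other `A m`, so it keeps the disjointed
  -- piece.
  obtain ⟨n, hn⟩ := hN (disjointed A) (disjoint_disjointed A)
  have hpos : disjointed A n ∈ (u n).1 := by
    rw [disjointed_eq_inter_compl]
    exact inter_mem (hA n) ((biInter_mem (finite_lt_nat n)).2 fun m hm => hdisj m n (ne_of_lt hm))
  exact Ultrafilter.compl_notMem_iff.2 hpos ((u n).2 hn)

/-- If only finitely many ultrafilters refine a countably complete filter, they are countably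
complete. -/
theorem Ultrafilter.countableInterFilter_of_finite {I : Type*} (N : Filter I)
    [CountableInterFilter N] (hfin : {u : Ultrafilter I | (u : Filter I) ≤ N}.Finite)
    (u : Ultrafilter I) (hu : (u : Filter I) ≤ N) : CountableInterFilter (u : Filter I) := by
  have hsep : ∀ v : Ultrafilter I, ∃ A ∈ u, v ≠ u → A ∉ v := fun v => by
    by_cases hv : v = u
    · exact ⟨univ, univ_mem, fun h => absurd hv h⟩
    · by_contra! H
      exact hv (Ultrafilter.coe_le_coe.1 fun A hA => (H A hA).2)
  choose A hAu hA using hsep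
  have hB : ⋂ v ∈ {u : Ultrafilter I | (u : Filter I) ≤ N}, A v ∈ u :=
    (biInter_mem hfin).2 fun v _ => hAu v
  -- The intersection of the `A v` isolates `u`: its complement lies in every other refinement.
  have hBN : ∀ T ∈ u, T ∪ (⋂ v ∈ {u : Ultrafilter I | (u : Filter I) ≤ N}, A v)ᶜ ∈ N := by
    intro T hT
    refine mem_iff_ultrafilter.2 fun v hv => ?_
    by_cases hvu : v = u
    · exact mem_of_superset (hvu ▸ hT) subset_union_left
    · refine mem_of_superset (Ultrafilter.compl_mem_iff_notMem.2 (hA v hvu)) ?_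
      exact fun i hi => Or.inr fun H => hi (mem_iInter₂.1 H v hv)
  refine ⟨fun S hS hmem => ?_⟩
  have hall := hu ((countable_bInter_mem hS).2 fun T hT => hBN T (hmem T hT))
  refine mem_of_superset (inter_mem hall hB) fun i hi T hT => ?_
  exact (mem_iInter₂.1 hi.1 T hT).resolve_right fun H => H hi.2

/-! ### Measurable cardinals and the conclusion -/

/-- A nonprincipal countably complete ultrafilter on `I` yields a measurable cardinal
`≤ |I|`. -/
theorem Ultrafilter.exists_isMeasurableCardinal_le {I : Type*} (u : Ultrafilter I)
    [CountableInterFilter (u : Filter I)] (hu : ∀ i, u ≠ pure i) :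
    ∃ κ, IsMeasurableCardinal κ ∧ κ ≤ Cardinal.mk I := by
  classical
  -- The measurable cardinal is the least size of a family in `u` whose intersection leaves `u`.
  let P : Set Cardinal := {κ | ∃ S : Set (Set I), Cardinal.mk S = κ ∧ (∀ s ∈ S, s ∈ u) ∧ ⋂₀ S ∉ u}
  have hcompl : ∀ i : I, ({i}ᶜ : Set I) ∈ u := fun i =>
    Ultrafilter.compl_mem_iff_notMem.2 fun h =>
      hu i (Ultrafilter.eq_pure_of_finite_mem (finite_singleton i) h |>.elim fun j hj => by
        rw [hj.2, mem_singleton_iff.1 hj.1])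
  have hPI : Cardinal.mk (range fun i : I => ({i}ᶜ : Set I)) ∈ P := by
    refine ⟨_, rfl, forall_mem_range.2 hcompl, ?_⟩
    have : ⋂₀ (range fun i : I => ({i}ᶜ : Set I)) = ∅ :=
      eq_empty_of_forall_notMem fun i hi => hi _ (mem_range_self i) rfl
    rw [this]
    exact Ultrafilter.empty_notMem
  obtain ⟨S, hSκ, hSu, hSn⟩ := csInf_mem (⟨_, hPI⟩ : P.Nonempty)
  have hκI : sInf P ≤ Cardinal.mk I := (csInf_le' hPI).trans Cardinal.mk_range_le
  have hcomplete : CardinalInterFilter (u : Filter I) (sInf P) := ⟨fun T hT hTu => by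
    by_contra hTn
    exact absurd (csInf_le' (show Cardinal.mk T ∈ P from ⟨T, rfl, hTu, hTn⟩)) (not_le.2 hT)⟩
  refine ⟨sInf P, ⟨?_, ?_⟩, hκI⟩
  · by_contra hle
    rw [not_lt, ← hSκ, Cardinal.le_aleph0_iff_set_countable] at hle
    exact hSn ((countable_sInter_mem hle).2 hSu)
  · obtain ⟨e⟩ : Nonempty (S ≃ (sInf P).out) := Cardinal.eq.1 (by rw [hSκ, Cardinal.mk_out])
    have hSne : Nonempty S := by
      by_contra hS
      rw [not_nonempty_iff, isEmpty_coe_sort] at hS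
      exact hSn (by rw [hS, sInter_empty]; exact univ_mem)
    -- Sending `i` to a member of `S` that misses it makes each fibre, off `⋂₀ S`, disjoint from a
    -- set in `u`; so the pushforward is nonprincipal.
    have hf : ∀ i, ∃ s : S, i ∉ ⋂₀ S → i ∉ s.1 := fun i => by
      by_cases hi : i ∈ ⋂₀ S
      · exact ⟨hSne.some, fun h => absurd hi h⟩
      · obtain ⟨s, hs, his⟩ := by simpa using hi
        exact ⟨⟨s, hs⟩, fun _ => his⟩
    choose f hf using hf
    refine ⟨u.map fun i => e (f i), ?_, fun a ha => ?_⟩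
    · rw [Ultrafilter.coe_map]
      infer_instance
    · have h1 : (fun i => e (f i)) ⁻¹' {a} ∈ u := by
        rw [← Ultrafilter.mem_map, ha]
        exact mem_singleton a
      have h2 := inter_mem (inter_mem h1 (Ultrafilter.compl_mem_iff_notMem.2 hSn))
        (hSu _ (e.symm a).2)
      refine Ultrafilter.empty_notMem (f := u) (mem_of_superset h2 fun i hi => ?_)
      have : f i = e.symm a := by rw [Equiv.eq_symm_apply]; exact hi.1.1
      exact hf i hi.1.2 (this ▸ hi.2)

theorem BelowLeastMeasurable.exists_eq_pure {I : Type*} (hI : BelowLeastMeasurable I)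
    (u : Ultrafilter I) [CountableInterFilter (u : Filter I)] : ∃ i, u = pure i := by
  by_contra! hne
  obtain ⟨κ, hκ, hle⟩ := u.exists_isMeasurableCardinal_le hne
  exact absurd (hI κ hκ) (not_lt.2 hle)

theorem exists_ultrafilters {I : Type*} [Nonempty I] (G : I → Type*) [∀ i, Group (G i)]
    {F : Type*} [Group F] [IsFreeGroup F] (h : unrestrictedFreeProduct G →* F) :
    ∃ (m : ℕ) (u : Fin (m + 1) → Ultrafilter I),
      (∀ k, CountableInterFilter (u k : Filter I)) ∧
      ∀ U : Fin (m + 1) → Set I, (∀ k, U k ∈ u k) → h = h.comp (projSet G (⋃ k, U k)) := by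
  have hfin := finite_ultrafilter_le (supportFilter h) (exists_compl_mem_supportFilter h)
  rcases eq_or_neBot (supportFilter h) with hbot | hbot
  -- If the filter is improper, every set supports `h` and any principal ultrafilter will do.
  · refine ⟨0, fun _ => pure (Classical.arbitrary I), fun _ => ?_, fun U _ => ?_⟩
    · rw [Ultrafilter.coe_pure, ← principal_singleton]
      infer_instance
    · rw [← mem_supportFilter, hbot]
      exact mem_bot
  · have := hfin.fintype
    obtain ⟨m, ⟨e⟩⟩ : ∃ m, Nonempty
        (Fin (m + 1) ≃ {u : Ultrafilter I | (u : Filter I) ≤ supportFilter h}) := by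
      have : Nonempty {u : Ultrafilter I | (u : Filter I) ≤ supportFilter h} :=
        ⟨⟨Ultrafilter.of _, Ultrafilter.of_le _⟩⟩
      obtain ⟨m, hm⟩ := Nat.exists_eq_succ_of_ne_zero
        (Fintype.card_ne_zero (α := {u : Ultrafilter I | (u : Filter I) ≤ supportFilter h}))
      exact ⟨m, ⟨(Fintype.equivFinOfCardEq hm).symm⟩⟩
    refine ⟨m, fun k => (e k).1, fun k =>
      Ultrafilter.countableInterFilter_of_finite _ hfin _ (e k).2, fun U hU => ?_⟩
    rw [← mem_supportFilter]
    refine mem_iff_ultrafilter.2 fun v hv => ?_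
    have hk : U (e.symm ⟨v, hv⟩) ∈ (e (e.symm ⟨v, hv⟩)).1 := hU (e.symm ⟨v, hv⟩)
    rw [Equiv.apply_symm_apply] at hk
    exact mem_of_superset hk (subset_iUnion U _)

theorem theorem1 {I : Type*} (G : I → Type*) [∀ i, Group (G i)]
    {F : Type*} [Group F] [IsFreeGroup F] (h : unrestrictedFreeProduct G →* F) :
    (Nonempty I →
      ∃ (m : ℕ) (u : Fin (m + 1) → Ultrafilter I),
        (∀ k, CountableInterFilter (u k : Filter I)) ∧
        (∀ U : Fin (m + 1) → Set I, (∀ k, U k ∈ u k) →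
          h = h.comp (projSet G (⋃ k, U k))) ∧
        (BelowLeastMeasurable I → ∀ k, ∃ i : I, u k = pure i)) ∧
    (BelowLeastMeasurable I →
      ∃ (X₀ : Finset I) (h' : Monoid.CoprodI (fun i : X₀ => G i) →* F),
        h = h'.comp (projFinset G X₀)) := by
  classical
  refine ⟨fun _ => ?_, fun hI => ?_⟩
  · obtain ⟨m, u, hu, hU⟩ := exists_ultrafilters G h
    exact ⟨m, u, hu, hU, fun hI k => have := hu k; hI.exists_eq_pure (u k)⟩
  · suffices H : ∃ X₀ : Finset I, h = h.comp (projSet G (X₀ : Set I)) from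
      H.imp fun X₀ hX₀ => exists_factor_projFinset h X₀ hX₀
    rcases isEmpty_or_nonempty I with hE | _
    · exact ⟨∅, by rw [Finset.coe_empty, ← univ_eq_empty_iff.2 hE, projSet_univ,
        MonoidHom.comp_id]⟩
    · obtain ⟨m, u, hu, hU⟩ := exists_ultrafilters G h
      choose i hi using fun k => have := hu k; hI.exists_eq_pure (u k)
      refine ⟨Finset.univ.image i, ?_⟩
      have := hU (fun k => {i k}) fun k => by rw [hi k]; exact mem_singleton _
      convert this
      ext j
      simp [eq_comm]
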